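/- All digraphs $D$ below are finite and have no loops. Let $M$ be a square $\{0,1\}$-matrix, not necessarily symmetric, with rows and columns indexed by a finite set $I$, having exactly $k$ diagonal entries equal to $0$ and exactly $\ell$ diagonal entries equal to $1$. An $M$-partition of $D$ is a partition of $V(D)$ into pairwise disjoint (possibly empty) parts $V_i$, $i\in I$, such that: $V_i$ is an independent set (there is no arc between vertices of $V_i$) if $M(i,i)=0$; $V_i$ is a strong clique (both arcs $(x,y)$ and $(y,x)$ are present for all distinct $x,y\in V_i$) if $M(i,i)=1$; and, for all $i\neq j$, no arc goes from $V_i$ to $V_j$ if $M(i,j)=0$, while all arcs from $V_i$ to $V_j$ are present if $M(i,j)=1$. A digraph $D$ is a minimal $M$-obstruction if $D$ does not admit an $M$-partition, but $D-v$ admits an $M$-partition for every vertex $v$ of $D$. Let $H$ be the digraph (possibly with loops) on the vertex set $I$ whose adjacency matrix is $M$; a full homomorphism of $D$ to $H$ is a map $f:V(D)\to I$ such that, for all distinct vertices $x,y$ of $D$, $(x,y)$ is an arc of $D$ if and only if $(f(x),f(y))$ is an arc of $H$. Then a digraph $D$ admits an $M$-partition if and only if it admits a full homomorphism to $H$, and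 every minimal $M$-obstruction $D$ satisfies $|V(D)|\le (k+1)(\ell+1)$. -/

import Mathlib

namespace Digraph

variable {V W ι : Type*}

/-- A digraph without loops. -/
def IsLoopless (D : Digraph V) : Prop := ∀ x, ¬ D.Adj x x

/-- The subdigraph induced by the complement of `v`, that is, `D - v`. -/
def deleteVertex (D : Digraph V) (v : V) : Digraph {x : V // x ≠ v} where
  Adj x y := D.Adj x y

/-- Both arcs are present between any two distinct vertices of `C`. -/
def IsStrongClique (D : Digraph V) (C : Set V) : Prop :=
  ∀ x ∈ C, ∀ y ∈ C, x ≠ y → D.Adj x y ∧ D.Adj y x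

/-- There is no arc between any two vertices of `I`. -/
def IsIndependent (D : Digraph V) (I : Set V) : Prop :=
  ∀ x ∈ I, ∀ y ∈ I, ¬ D.Adj x y ∧ ¬ D.Adj y x

/-- Every arc from `S` to `T` is present. -/
def CompletelyAdjacent (D : Digraph V) (S T : Set V) : Prop :=
  ∀ x ∈ S, ∀ y ∈ T, D.Adj x y

/-- No arc from `S` to `T` is present. -/
def CompletelyNonAdjacent (D : Digraph V) (S T : Set V) : Prop :=
  ∀ x ∈ S, ∀ y ∈ T, ¬ D.Adj x y

/-- `P` is an `M`-partition of `D`: a family of pairwise disjoint, possibly empty, parts that cover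
the vertex set and satisfy the constraints encoded by the `{0,1}`-matrix `M`. -/
structure IsMatrixPartition (D : Digraph V) (M : Matrix ι ι (Fin 2)) (P : ι → Set V) : Prop where
  pairwise_disjoint : ∀ i j, i ≠ j → Disjoint (P i) (P j)
  cover : ⋃ i, P i = Set.univ
  independent : ∀ i, M i i = 0 → D.IsIndependent (P i)
  strongClique : ∀ i, M i i = 1 → D.IsStrongClique (P i)
  nonAdjacent : ∀ i j, i ≠ j → M i j = 0 → D.CompletelyNonAdjacent (P i) (P j)
  adjacent : ∀ i j, i ≠ j → M i j = 1 → D.CompletelyAdjacent (P i) (P j)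

/-- `D` admits an `M`-partition. -/
def HasMatrixPartition (D : Digraph V) (M : Matrix ι ι (Fin 2)) : Prop :=
  ∃ P : ι → Set V, D.IsMatrixPartition M P

/-- `D` is a minimal obstruction to `M`-partition. -/
def IsMinimalObstruction (D : Digraph V) (M : Matrix ι ι (Fin 2)) : Prop :=
  ¬ D.HasMatrixPartition M ∧ ∀ v, (D.deleteVertex v).HasMatrixPartition M

/-- The digraph (possibly with loops) whose adjacency matrix is `M`. -/
def ofMatrix (M : Matrix ι ι (Fin 2)) : Digraph ι where
  Adj i j := M i j = 1

/-- Full homomorphisms, where only pairs of distinct vertices are constrained. -/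
def IsFullHom (D : Digraph V) (H : Digraph W) (f : V → W) : Prop :=
  ∀ x y, x ≠ y → (D.Adj x y ↔ H.Adj (f x) (f y))

end Digraph

/-! Colour `true` stands for arcs, `false` for non-arcs. After the deletion of `v`, two vertices in
a part of colour `c` are twins in `D - v`: related in both directions by `c`, and seen alike by
every other vertex. If `v` has a `c`-twin `x` in `D`, the part of `x` has the opposite colour, as
otherwise `v` could join it; hence the `c`-twins of `v` occupy distinct opposite parts
(`IsCritical.color_of_twin`, `IsCritical.injOn_twinClass`). Each remaining part lies in a twin class
of `D`, and summing sizes gives `IsCritical.card_le_of_twin`.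

If a largest class of its colour has three or more vertices, the parts of the twins of `v` are
singletons and the sum gives exactly the bound. If classes have at most two vertices, failure of the
bound yields a vertex without twins (`IsCritical.exists_untwinned`), and finer counting refutes
this. Without twins, Bondy's theorem (`exists_redundant_coordinate`) provides a vertex whose
deletion creates no twins of a chosen colour, so the parts of that colour have at most one vertex;
parts with three or more vertices are treated in `IsCritical.card_le_of_large_part`.

Letting a vertex see itself in colour `c` turns twins into equal vectors, so that twinship is an
equivalence and Bondy's theorem applies. -/

namespace Digraph

/-! ### Bondy's theorem on separating coordinates -/

section Bondy

variable {X Y β : Type*}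

/-- Distinct vectors indexed by a nonempty finite set `S` are separated by fewer than `S.card`
coordinates. -/
theorem exists_separating_coordinates (g : X → Y → β) (hg : Function.Injective g)
    (S : Finset X) (hS : S.Nonempty) :
    ∃ T : Finset Y, T.card < S.card ∧
      ∀ x ∈ S, ∀ y ∈ S, (∀ z ∈ T, g x z = g y z) → x = y := by
  classical
  induction hS using Finset.Nonempty.cons_induction with
  | singleton a => exact ⟨∅, by simp, by simp⟩
  | cons s S hs hS ih =>
    obtain ⟨T, hT, hsep⟩ := ih
    -- Since `T` separates `S`, at most one `t` in `S` agrees with `s` on `T`; one more coordinate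
    -- splits them.
    by_cases h : ∃ t ∈ S, ∀ z ∈ T, g s z = g t z
    · obtain ⟨t, ht, hst⟩ := h
      have hne : g s ≠ g t := fun e => hs (hg e ▸ ht)
      obtain ⟨w, hw⟩ := Function.ne_iff.1 hne
      have key : ∀ y ∈ S, (∀ z ∈ insert w T, g s z = g y z) → False := by
        intro y hy hz
        have : t = y := hsep t ht y hy fun z hzT =>
          (hst z hzT).symm.trans (hz z (Finset.mem_insert_of_mem hzT))
        subst this
        exact hw (hz w (Finset.mem_insert_self _ _))
      refine ⟨insert w T, ?_, ?_⟩
      · have := Finset.card_insert_le w T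
        rw [Finset.card_cons]; omega
      · intro x hx y hy hxy
        rcases Finset.mem_cons.1 hx with rfl | hxS <;> rcases Finset.mem_cons.1 hy with rfl | hyS
        · rfl
        · exact (key y hyS hxy).elim
        · exact (key x hxS fun z hz => (hxy z hz).symm).elim
        · exact hsep x hxS y hyS fun z hz => hxy z (Finset.mem_insert_of_mem hz)
    · push Not at h
      refine ⟨T, by rw [Finset.card_cons]; omega, ?_⟩
      intro x hx y hy hxy
      rcases Finset.mem_cons.1 hx with rfl | hxS <;> rcases Finset.mem_cons.1 hy with rfl | hyS
      · rfl
      · obtain ⟨z, hz, hne⟩ := h y hyS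
        exact (hne (hxy z hz)).elim
      · obtain ⟨z, hz, hne⟩ := h x hxS
        exact (hne (hxy z hz).symm).elim
      · exact hsep x hxS y hyS hxy

/-- Bondy's theorem: among `n` coordinates, some coordinate is not needed to tell `n` distinct
vectors apart. -/
theorem exists_redundant_coordinate [Finite X] [Nonempty X] (g : X → X → β)
    (hg : Function.Injective g) :
    ∃ v, ∀ x y, (∀ z, z ≠ v → g x z = g y z) → x = y := by
  classical
  have := Fintype.ofFinite X
  obtain ⟨T, hT, hsep⟩ := exists_separating_coordinates g hg Finset.univ Finset.univ_nonempty
  obtain ⟨v, -, hv⟩ := Finset.exists_mem_notMem_of_card_lt_card hT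
  refine ⟨v, fun x y hxy => hsep x (Finset.mem_univ _) y (Finset.mem_univ _) fun z hz => ?_⟩
  exact hxy z fun e => hv (e ▸ hz)

end Bondy

/-! ### Twins, and how they survive the restoration of a vertex -/

section Twins

variable {V : Type*} (A : V → V → Bool)

open Classical in
/-- How `z` sees `x`, where every vertex is taken to see itself in colour `c`. -/
noncomputable def code (c : Bool) (x z : V) : Bool × Bool :=
  if x = z then (c, c) else (A x z, A z x)

/-- `x` and `y` are twins of colour `c` after the vertices in `S` are deleted. -/
def TwinOff (c : Bool) (S : Set V) (x y : V) : Prop :=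
  ∀ z, z ∉ S → code A c x z = code A c y z

variable {A} {c d : Bool} {S : Set V} {v x y z : V}

theorem code_self : code A c x x = (c, c) := if_pos rfl

theorem code_of_ne (h : x ≠ z) : code A c x z = (A x z, A z x) := if_neg h

namespace TwinOff

theorem refl (x : V) : TwinOff A c S x x := fun _ _ => rfl

theorem symm (h : TwinOff A c S x y) : TwinOff A c S y x := fun z hz => (h z hz).symm

theorem trans (h : TwinOff A c S x y) (h' : TwinOff A c S y z) : TwinOff A c S x z :=
  fun w hw => (h w hw).trans (h' w hw)

theorem mono {T : Set V} (h : TwinOff A c S x y) (hST : S ⊆ T) : TwinOff A c T x y :=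
  fun z hz => h z fun hS => hz (hST hS)

theorem color (h : TwinOff A c S x y) (hx : x ∉ S) (hne : x ≠ y) :
    A x y = c ∧ A y x = c := by
  have := h x hx
  rw [code_self, code_of_ne hne.symm, Prod.mk.injEq] at this
  exact ⟨this.2.symm, this.1.symm⟩

theorem third (h : TwinOff A c S x y) (hz : z ∉ S) (hx : z ≠ x) (hy : z ≠ y) :
    A x z = A y z ∧ A z x = A z y := by
  have := h z hz
  rwa [code_of_ne hx.symm, code_of_ne hy.symm, Prod.mk.injEq] at this

theorem of_color_third (hxy : A x y = c ∧ A y x = c)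
    (h : ∀ z, z ∉ S → z ≠ x → z ≠ y → A x z = A y z ∧ A z x = A z y) :
    TwinOff A c S x y := by
  intro z hz
  by_cases hne : x = y
  · rw [hne]
  by_cases hx : z = x
  · subst hx
    rw [code_self, code_of_ne (Ne.symm hne), hxy.1, hxy.2]
  by_cases hy : z = y
  · subst hy
    rw [code_self, code_of_ne hne, hxy.1, hxy.2]
  rw [code_of_ne (Ne.symm hx), code_of_ne (Ne.symm hy), (h z hz hx hy).1, (h z hz hx hy).2]

/-- A vertex does not have twins of both colours. -/
theorem color_unique (h : TwinOff A c S x y) (h' : TwinOff A d S x z) (hx : x ∉ S) (hy : y ∉ S)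
    (hz : z ∉ S) (hxy : x ≠ y) (hxz : x ≠ z) : c = d := by
  by_cases hyz : y = z
  · subst hyz
    exact (h.color hx hxy).1.symm.trans (h'.color hx hxz).1
  -- The colours meet in the chain `c = A y x = A y z = A x z = d`.
  have h1 := h.third hz hxz.symm (Ne.symm hyz)
  have h2 := h'.third hy hxy.symm hyz
  exact (h.color hx hxy).2.symm.trans (h2.2.trans (h1.1.symm.trans (h'.color hx hxz).1))

/-- Twins in `D - v` are twins in `D` if `v` sees them in the same way. -/
theorem of_deleted (h : TwinOff A c {v} x y) (hv : code A c x v = code A c y v) :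
    TwinOff A c ∅ x y := by
  intro z _
  by_cases hz : z = v
  · rw [hz, hv]
  · exact h z hz

/-- If `v` has a twin `x`, then twins in `D - v` other than `x` are twins in `D`. -/
theorem of_deleted_twin (hvx : TwinOff A c ∅ v x) (hne : v ≠ x) (h : TwinOff A d {v} y z)
    (hy : y ≠ v) (hz : z ≠ v) (hyx : y ≠ x) (hzx : z ≠ x) : TwinOff A d ∅ y z := by
  refine h.of_deleted ?_
  -- `v` sees `y` and `z` as `x` does, and `x`, still present, does not distinguish them.
  have h1 := hvx.third (Set.notMem_empty _) hy hyx
  have h2 := hvx.third (Set.notMem_empty _) hz hzx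
  have h3 := h x hne.symm
  rw [code_of_ne hyx, code_of_ne hzx] at h3
  rw [code_of_ne hy, code_of_ne hz, h1.1, h1.2, h2.1, h2.2, h3]

/-- If `v` has a twin, then twins of the same colour in `D - v` are twins in `D`. -/
theorem of_deleted_same (hvx : TwinOff A c ∅ v x) (hne : v ≠ x) (h : TwinOff A c {v} y z)
    (hy : y ≠ v) (hz : z ≠ v) : TwinOff A c ∅ y z := by
  have key : ∀ w, w ≠ v → TwinOff A c {v} x w → TwinOff A c ∅ x w := by
    intro w hw hxw
    by_cases hwx : w = x
    · rw [hwx]; exact refl _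
    have h1 := hvx.third (Set.notMem_empty _) hw hwx
    have h2 := hxw.color (S := {v}) hne.symm (Ne.symm hwx)
    have h3 := hvx.color (Set.notMem_empty _) hne
    refine hxw.of_deleted ?_
    rw [code_of_ne hne.symm, code_of_ne hw, h1.1, h1.2, h2.1, h2.2, h3.1, h3.2]
  by_cases hyx : y = x
  · subst hyx; exact key z hz h
  by_cases hzx : z = x
  · subst hzx; exact (key y hy h.symm).symm
  exact of_deleted_twin hvx hne h hy hz hyx hzx

end TwinOff

end Twins

/-! ### Critical digraphs, twin classes and parts -/

section Critical

variable {V ι : Type*} (A : V → V → Bool) (M : ι → ι → Bool)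

/-- `f` is a full homomorphism after the vertex `v` is deleted. -/
def IsFullHomOff (v : V) (f : V → ι) : Prop :=
  ∀ x y, x ≠ v → y ≠ v → x ≠ y → A x y = M (f x) (f y)

/-- There is no full homomorphism, but there is one after the deletion of any vertex. -/
structure IsCritical : Prop where
  not_hom : ¬ ∃ f : V → ι, ∀ x y, x ≠ y → A x y = M (f x) (f y)
  hom_off : ∀ v, ∃ f : V → ι, IsFullHomOff A M v f

variable {A M} {c d : Bool} {v x y : V} {f : V → ι}

theorem IsFullHomOff.twin (hf : IsFullHomOff A M v f) (hx : x ≠ v) (hy : y ≠ v)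
    (hxy : f x = f y) : TwinOff A (M (f x) (f x)) {v} x y := by
  by_cases hne : x = y
  · rw [hne]; exact TwinOff.refl _
  refine TwinOff.of_color_third ⟨?_, ?_⟩ fun z hz hzx hzy => ⟨?_, ?_⟩
  · rw [hf x y hx hy hne, hxy]
  · rw [hf y x hy hx (Ne.symm hne), hxy]
  · rw [hf x z hx hz hzx.symm, hf y z hy hz hzy.symm, hxy]
  · rw [hf z x hz hx hzx, hf z y hz hy hzy, hxy]

/-- The part of a twin of the deleted vertex has the opposite colour. -/
theorem IsCritical.color_of_twin (h : IsCritical A M) (hf : IsFullHomOff A M v f)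
    (hvx : TwinOff A c ∅ v x) (hne : v ≠ x) : M (f x) (f x) = !c := by
  classical
  by_contra hc
  have hc : M (f x) (f x) = c := by cases c <;> simpa using hc
  -- With equal colours, `v` can be put into the part of its twin `x`.
  refine h.not_hom ⟨Function.update f v (f x), ?_⟩
  have key : ∀ z, z ≠ v → A v z = M (f x) (f z) ∧ A z v = M (f z) (f x) := by
    intro z hz
    by_cases hzx : z = x
    · rw [hzx, hc]; exact hvx.color (Set.notMem_empty _) hne
    · have := hvx.third (Set.notMem_empty _) hz hzx
      rw [this.1, this.2, hf x z hne.symm hz (Ne.symm hzx), hf z x hz hne.symm hzx]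
      exact ⟨rfl, rfl⟩
  intro a b hab
  by_cases ha : a = v
  · subst ha
    rw [Function.update_self, Function.update_of_ne hab.symm]
    exact (key b hab.symm).1
  · rw [Function.update_of_ne ha]
    by_cases hb : b = v
    · subst hb
      rw [Function.update_self]
      exact (key a ha).2
    · rw [Function.update_of_ne hb]
      exact hf a b ha hb hab

/-- The vertices of a twin class are in distinct parts after one of them is deleted. -/
theorem IsCritical.injOn_twinClass (hf : IsFullHomOff A M v f) (h : IsCritical A M) {x y : V}
    (hx : TwinOff A c ∅ v x) (hy : TwinOff A c ∅ v y) (hxv : v ≠ x) (hyv : v ≠ y)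
    (hxy : f x = f y) : x = y := by
  by_contra hne
  have h1 := (hf.twin hxv.symm hyv.symm hxy).color (S := {v}) hxv.symm hne
  have h2 := (hx.symm.trans hy).color (Set.notMem_empty _) hne
  rw [h.color_of_twin hf hx hxv, h2.1] at h1
  cases c <;> simp at h1

variable [Fintype V]

open Classical in
/-- The class of twins of colour `c` that contains `x`. -/
noncomputable def twinClass (A : V → V → Bool) (c : Bool) (x : V) : Finset V :=
  Finset.univ.filter fun y => TwinOff A c ∅ x y

open Classical in
/-- The part with index `i`, after the vertex `v` is deleted. -/
noncomputable def part (v : V) (f : V → ι) (i : ι) : Finset V :=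
  Finset.univ.filter fun x => x ≠ v ∧ f x = i

theorem mem_twinClass : y ∈ twinClass A c x ↔ TwinOff A c ∅ x y := by simp [twinClass]

theorem card_twinClass_le_one (h : ∀ y, TwinOff A c ∅ x y → x = y) :
    (twinClass A c x).card ≤ 1 :=
  Finset.card_le_one.2 fun a ha b hb =>
    (h a (mem_twinClass.1 ha)).symm.trans (h b (mem_twinClass.1 hb))

theorem mem_part {i : ι} : x ∈ part v f i ↔ x ≠ v ∧ f x = i := by simp [part]

/-- A part of `D - v` whose vertices are all twins of `x` in `D` is contained in the class
of `x`. -/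
theorem card_part_le {a : ℕ} {i : ι} (ha : ∀ x, (twinClass A c x).card ≤ a)
    (h : ∀ x ∈ part v f i, ∀ y ∈ part v f i, TwinOff A c ∅ x y) : (part v f i).card ≤ a := by
  rcases (part v f i).eq_empty_or_nonempty with h0 | ⟨x, hx⟩
  · simp [h0]
  · exact (Finset.card_le_card fun y hy => mem_twinClass.2 (h x hx y hy)).trans (ha x)

open Classical in
theorem IsCritical.card_image_twinClass (h : IsCritical A M) (hf : IsFullHomOff A M v f) (c : Bool) :
    (((twinClass A c v).erase v).image f).card + 1 = (twinClass A c v).card := by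
  rw [Finset.card_image_of_injOn]
  · exact Finset.card_erase_add_one (mem_twinClass.2 (TwinOff.refl _))
  · intro x hx y hy hxy
    simp only [Finset.coe_erase, Set.mem_sdiff, Finset.mem_coe, mem_twinClass,
      Set.mem_singleton_iff] at hx hy
    exact IsCritical.injOn_twinClass hf h hx.1 hy.1 (Ne.symm hx.2) (Ne.symm hy.2) hxy

variable [Fintype ι]

/-- The indices of colour `c`. -/
def colorIndices (M : ι → ι → Bool) (c : Bool) : Finset ι :=
  Finset.univ.filter fun i => M i i = c

theorem mem_colorIndices {i : ι} : i ∈ colorIndices M c ↔ M i i = c := by simp [colorIndices]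

theorem card_eq_sum_parts (M : ι → ι → Bool) (c : Bool) (v : V) (f : V → ι) :
    Fintype.card V = 1 + ∑ i ∈ colorIndices M c, (part v f i).card +
      ∑ i ∈ colorIndices M (!c), (part v f i).card := by
  classical
  have h1 : (Finset.univ.erase v).card = ∑ i : ι, (part v f i).card := by
    rw [Finset.card_eq_sum_card_fiberwise (f := f) (t := Finset.univ) (by simp)]
    refine Finset.sum_congr rfl fun i _ => congrArg _ ?_
    ext x; simp [mem_part]
  rw [Finset.card_erase_of_mem (Finset.mem_univ _), Finset.card_univ] at h1
  have h2 := Finset.sum_filter_add_sum_filter_not Finset.univ (fun i => M i i = c)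
    fun i => (part v f i).card
  have h3 : (Finset.univ.filter fun i => ¬ M i i = c) = colorIndices M (!c) := by
    ext i; simp only [Finset.mem_filter, Finset.mem_univ, true_and, mem_colorIndices]
    cases c <;> simp
  rw [h3] at h2
  have h4 : 0 < Fintype.card V := Fintype.card_pos_iff.2 ⟨v⟩
  change ∑ i ∈ colorIndices M c, _ + _ = _ at h2
  omega

theorem card_colorIndices_add (M : ι → ι → Bool) (c : Bool) :
    (colorIndices M c).card + (colorIndices M (!c)).card = Fintype.card ι := by
  classical
  rw [← Finset.card_univ,
    ← Finset.card_filter_add_card_filter_not (s := Finset.univ) (fun i => M i i = c)]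
  refine congrArg ((colorIndices M c).card + Finset.card ·) ?_
  ext i; simp only [Finset.mem_filter, Finset.mem_univ, true_and, mem_colorIndices]
  cases c <;> simp

/-! ### Bounding the number of vertices -/

namespace IsCritical

open Classical in
theorem image_twinClass_subset (h : IsCritical A M) (hf : IsFullHomOff A M v f) (c : Bool) :
    ((twinClass A c v).erase v).image f ⊆ colorIndices M (!c) := by
  intro i hi
  obtain ⟨x, hx, rfl⟩ := Finset.mem_image.1 hi
  rw [Finset.mem_erase, mem_twinClass] at hx
  exact mem_colorIndices.2 (h.color_of_twin hf hx.2 hx.1.symm)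

/-- The twins of `v` inject into the indices of the opposite colour; the extra 1 counts `v`. -/
theorem card_twinClass_le (h : IsCritical A M) (c : Bool) (v : V) :
    (twinClass A c v).card ≤ (colorIndices M (!c)).card + 1 := by
  classical
  obtain ⟨f, hf⟩ := h.hom_off v
  rw [← h.card_image_twinClass hf c]
  exact Nat.add_le_add_right (Finset.card_le_card (h.image_twinClass_subset hf c)) 1

/-- The number of vertices, counted after the deletion of a vertex `v` with a twin. -/
theorem card_le_of_twin (h : IsCritical A M) (hf : IsFullHomOff A M v f) {a b s : ℕ}
    (hvx : TwinOff A c ∅ v x) (hne : v ≠ x)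
    (ha : ∀ x, (twinClass A c x).card ≤ a) (hb : ∀ x, (twinClass A (!c) x).card ≤ b)
    (hs : ∀ x, TwinOff A c ∅ v x → v ≠ x → (part v f (f x)).card ≤ s) :
    Fintype.card V + ((twinClass A c v).card - 1) * b ≤
      1 + (colorIndices M c).card * a + ((twinClass A c v).card - 1) * s +
        (colorIndices M (!c)).card * b := by
  classical
  set J := ((twinClass A c v).erase v).image f with hJ
  have hJc : J.card = (twinClass A c v).card - 1 := by
    rw [← h.card_image_twinClass hf c, ← hJ, Nat.add_sub_cancel]
  have hsub : J ⊆ colorIndices M (!c) := h.image_twinClass_subset hf c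
  have h1 : ∑ i ∈ colorIndices M c, (part v f i).card ≤ (colorIndices M c).card * a := by
    refine Finset.sum_le_card_nsmul _ _ _ fun i hi => card_part_le ha fun x hx y hy => ?_
    rw [mem_part] at hx hy
    rw [mem_colorIndices] at hi
    have := hf.twin hx.1 hy.1 (hx.2.trans hy.2.symm)
    rw [hx.2, hi] at this
    exact TwinOff.of_deleted_same hvx hne this hx.1 hy.1
  have h2 : ∑ i ∈ J, (part v f i).card ≤ J.card * s := by
    refine Finset.sum_le_card_nsmul _ _ _ fun i hi => ?_
    obtain ⟨w, hw, rfl⟩ := Finset.mem_image.1 hi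
    rw [Finset.mem_erase, mem_twinClass] at hw
    exact hs w hw.2 hw.1.symm
  have h3 : ∑ i ∈ colorIndices M (!c) \ J, (part v f i).card ≤
      (colorIndices M (!c) \ J).card * b := by
    refine Finset.sum_le_card_nsmul _ _ _ fun i hi => card_part_le hb fun y hy z hz => ?_
    rw [mem_part] at hy hz
    rw [Finset.mem_sdiff, mem_colorIndices] at hi
    -- A part outside `J` avoids `x`, the only obstacle to `of_deleted_twin`.
    have hx : x ∈ (twinClass A c v).erase v :=
      Finset.mem_erase.2 ⟨hne.symm, mem_twinClass.2 hvx⟩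
    have := hf.twin hy.1 hz.1 (hy.2.trans hz.2.symm)
    rw [hy.2, hi.1] at this
    refine TwinOff.of_deleted_twin hvx hne this hy.1 hz.1 ?_ ?_
    · rintro rfl; exact hi.2 (hy.2 ▸ Finset.mem_image_of_mem f hx)
    · rintro rfl; exact hi.2 (hz.2 ▸ Finset.mem_image_of_mem f hx)
  have h4 := Finset.sum_sdiff (f := fun i => (part v f i).card) hsub
  have h5 := Finset.card_sdiff_add_card_eq_card hsub
  have h6 := card_eq_sum_parts M c v f
  rw [← hJc]
  calc Fintype.card V + J.card * b
      ≤ 1 + (colorIndices M c).card * a + J.card * s +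
        (colorIndices M (!c) \ J).card * b + J.card * b := by omega
    _ = _ := by rw [← h5]; ring

/-- The bound, if some vertex of a largest twin class can be deleted so that its twins become
singleton parts. -/
theorem card_le_of_singleton_parts (h : IsCritical A M) (hf : IsFullHomOff A M v f)
    (hvx : TwinOff A c ∅ v x) (hne : v ≠ x)
    (ha : ∀ x, (twinClass A c x).card ≤ (twinClass A c v).card)
    (hs : ∀ x, TwinOff A c ∅ v x → v ≠ x → (part v f (f x)).card ≤ 1) :
    Fintype.card V ≤ ((colorIndices M c).card + 1) * ((colorIndices M (!c)).card + 1) := by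
  have hb : ∀ x, (twinClass A (!c) x).card ≤ (colorIndices M c).card + 1 := fun x => by
    simpa using h.card_twinClass_le (!c) x
  have h1 := h.card_le_of_twin hf hvx hne ha hb hs
  obtain ⟨a, h2⟩ : ∃ a, (twinClass A c v).card = a + 1 :=
    Nat.exists_eq_add_one.2 (Finset.card_pos.2 ⟨v, mem_twinClass.2 (TwinOff.refl _)⟩)
  rw [h2, Nat.add_sub_cancel] at h1
  -- With `b = k + 1`, `s = 1` and class size `a + 1`, all terms in `a` cancel.
  nlinarith

/-- The bound, if there is a twin class with more than two vertices. -/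
theorem card_le_of_large_twinClass (h : IsCritical A M) (hv : 3 ≤ (twinClass A c v).card)
    (ha : ∀ x, (twinClass A c x).card ≤ (twinClass A c v).card) :
    Fintype.card V ≤ ((colorIndices M c).card + 1) * ((colorIndices M (!c)).card + 1) := by
  classical
  obtain ⟨f, hf⟩ := h.hom_off v
  obtain ⟨x, hx, hxv⟩ := Finset.exists_mem_ne (by omega : 1 < (twinClass A c v).card) v
  refine h.card_le_of_singleton_parts hf (mem_twinClass.1 hx) hxv.symm ha fun w hw hwv => ?_
  -- A second twin `u` keeps `w` a `c`-twin in `D - v`, so `w` has no twin of the other colour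
  -- there.
  have h2 : ∃ u ∈ (twinClass A c v).erase v, u ≠ w := by
    refine Finset.exists_mem_ne ?_ w
    rw [Finset.card_erase_of_mem (mem_twinClass.2 (TwinOff.refl _))]
    omega
  obtain ⟨u, hu, huw⟩ := h2
  rw [Finset.mem_erase, mem_twinClass] at hu
  have key : ∀ y ∈ part v f (f w), w = y := by
    intro y hy
    rw [mem_part] at hy
    by_contra hwy
    have h3 := hf.twin hwv.symm hy.1 hy.2.symm
    rw [h.color_of_twin hf hw hwv] at h3
    have h4 : TwinOff A c {v} w u := (hw.symm.trans hu.2).mono (Set.empty_subset _)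
    have := h4.color_unique h3 hwv.symm hu.1 hy.1 huw.symm hwy
    cases c <;> simp at this
  exact Finset.card_le_one.2 fun a ha b hb => (key a ha).symm.trans (key b hb)

/-- Suppose that all twin classes have at most two vertices, and that `v`, `x` are twins. If the
bound fails, then after the deletion of `v` the part of `x` consists of `x` and a vertex `y`
without twins. -/
theorem exists_untwinned (h : IsCritical A M)
    (hcard : ((colorIndices M c).card + 1) * ((colorIndices M (!c)).card + 1) < Fintype.card V)
    (h2 : ∀ c x, (twinClass A c x).card ≤ 2) (hvx : TwinOff A c ∅ v x) (hne : v ≠ x)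
    (hf : IsFullHomOff A M v f) :
    ∃ y, y ≠ v ∧ A v y = (!c) ∧ A y v = (!c) ∧ (∀ d z, TwinOff A d ∅ y z → y = z) ∧
      ∀ z ∈ part v f (f x), z = x ∨ z = y := by
  classical
  have two : ∀ {c : Bool} {v x w : V}, TwinOff A c ∅ v x → v ≠ x → TwinOff A c ∅ v w → v ≠ w →
      w = x := by
    intro c v x w hx hvx hw hvw
    by_contra hwx
    have : ({v, x, w} : Finset V) ⊆ twinClass A c v := by
      intro t ht
      simp only [Finset.mem_insert, Finset.mem_singleton] at ht
      rw [mem_twinClass]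
      rcases ht with rfl | rfl | rfl
      exacts [TwinOff.refl _, hx, hw]
    have h3 := (Finset.card_le_card this).trans (h2 c v)
    rw [Finset.card_eq_three.2 ⟨v, x, w, hvx, hvw, Ne.symm hwx, rfl⟩] at h3
    omega
  -- Stated for any colour and vertices, as it is used again for `y` and `z` with the colours
  -- exchanged.
  have exists_mate : ∀ {c : Bool} {v x : V} {f : V → ι},
      ((colorIndices M c).card + 1) * ((colorIndices M (!c)).card + 1) < Fintype.card V →
      TwinOff A c ∅ v x → v ≠ x → IsFullHomOff A M v f → ∃ y, y ≠ v ∧ y ≠ x ∧ f y = f x := by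
    intro c v x f hcard hvx hne hf
    by_contra hno
    push Not at hno
    refine absurd (h.card_le_of_singleton_parts hf hvx hne (fun w => (h2 c w).trans ?_) ?_)
      (not_le.2 hcard)
    · rw [← Finset.card_pair hne]
      refine Finset.card_le_card fun t ht => mem_twinClass.2 ?_
      rcases Finset.mem_insert.1 ht with rfl | ht
      · exact TwinOff.refl _
      · rw [Finset.mem_singleton.1 ht]; exact hvx
    · intro w hw hvw
      have hwx := two hvx hne hw hvw
      subst hwx
      have key : ∀ y ∈ part v f (f w), y = w := by
        intro y hy
        rw [mem_part] at hy
        by_contra hyw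
        exact hno y hy.1 hyw hy.2
      exact Finset.card_le_one.2 fun a ha b hb => (key a ha).trans (key b hb).symm
  obtain ⟨y, hyv, hyx, hfy⟩ := exists_mate hcard hvx hne hf
  have hxy : TwinOff A (!c) {v} x y := by
    have := hf.twin hne.symm hyv hfy.symm
    rwa [h.color_of_twin hf hvx hne] at this
  have hcol := hxy.color (S := {v}) hne.symm hyx.symm
  have hvy := hvx.third (Set.notMem_empty _) hyv hyx
  rw [hcol.1, hcol.2] at hvy
  have hcc : c ≠ !c := by cases c <;> simp
  have hsame : ∀ z, TwinOff A c ∅ y z → y = z := by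
    intro z hz
    by_contra hyz
    by_cases hzv : z = v
    · subst hzv
      exact hcc ((hz.color (Set.notMem_empty _) hyz).1.symm.trans hvy.2)
    · exact hcc ((hz.mono (Set.empty_subset _)).color_unique (S := {v}) hxy.symm hyv hzv
        hne.symm hyz hyx)
  have hopp : ∀ z, TwinOff A (!c) ∅ y z → y = z := by
    intro z hz
    by_contra hyz
    have hzx : z ≠ x := by
      rintro rfl
      exact hcc (hvx.symm.color_unique hz.symm (Set.notMem_empty _) (Set.notMem_empty _)
        (Set.notMem_empty _) hne.symm hyx.symm)
    have hzv : z ≠ v := by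
      rintro rfl
      exact hcc (hvx.color_unique hz.symm (Set.notMem_empty _) (Set.notMem_empty _)
        (Set.notMem_empty _) hne hyv.symm)
    obtain ⟨g, hg⟩ := h.hom_off y
    obtain ⟨r, hry, hrz, hgr⟩ := exists_mate (c := !c) (by rw [Bool.not_not, mul_comm]; exact hcard)
      hz hyz hg
    have hrz' : TwinOff A c {y} z r := by
      have := hg.twin (Ne.symm hyz) hry hgr.symm
      rwa [h.color_of_twin hg hz hyz, Bool.not_not] at this
    have h3 := hrz'.color (S := {y}) (Ne.symm hyz) hrz.symm
    have h4 := hz.third (Set.notMem_empty _) hry hrz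
    have hry' : A r y = c := h4.2.trans h3.2
    have hrx : r ≠ x := by
      rintro rfl
      exact hcc (hry'.symm.trans hcol.1)
    have hrv : r ≠ v := by
      rintro rfl
      exact hcc (hry'.symm.trans hvy.1)
    have h5 := hxy.third (S := {v}) hrv hrx hry
    have h6 := hrz'.third (S := {y}) hyx.symm hzx.symm hrx.symm
    have h7 := hxy.third (S := {v}) hzv hzx (Ne.symm hyz)
    have h8 := hz.color (Set.notMem_empty _) hyz
    -- The contradiction is `c = A r y = A r x = A z x = A z y = !c`.
    exact hcc (hry'.symm.trans (h5.2.symm.trans (h6.1.symm.trans (h7.2.trans h8.2))))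
  refine ⟨y, hyv, hvy.1, hvy.2, fun d => ?_, fun z hz => ?_⟩
  · by_cases hd : d = c
    · rw [hd]; exact hsame
    · have : d = !c := by cases c <;> cases d <;> simp_all
      rw [this]; exact hopp
  · by_contra hzz
    push Not at hzz
    rw [mem_part] at hz
    have h3 := hf.twin hyv hz.1 (hfy.trans hz.2.symm)
    rw [hfy, h.color_of_twin hf hvx hne] at h3
    exact hzz.2 (hopp z (TwinOff.of_deleted_twin hvx hne h3 hyv hz.1 hyx hzz.1)).symm

/-- The bound, if all twin classes have at most two vertices, there is a twin class of colour `c`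
with two vertices, and there is only one part of the opposite colour. -/
theorem card_le_of_unique_index (h : IsCritical A M) (hl : (colorIndices M (!c)).card = 1)
    (h2 : ∀ c x, (twinClass A c x).card ≤ 2) (hvx : TwinOff A c ∅ v x) (hne : v ≠ x) :
    Fintype.card V ≤ ((colorIndices M c).card + 1) * ((colorIndices M (!c)).card + 1) := by
  classical
  by_contra hcard
  rw [not_le] at hcard
  obtain ⟨f, hf⟩ := h.hom_off v
  obtain ⟨y, hyv, -, -, hy, hpart⟩ := h.exists_untwinned hcard h2 hvx hne hf
  obtain ⟨j, hj⟩ := Finset.card_eq_one.1 hl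
  have hfx : f x = j := by
    have := mem_colorIndices.2 (h.color_of_twin hf hvx hne)
    rwa [hj, Finset.mem_singleton] at this
  have hcn : ∀ i, i ∉ colorIndices M c → i = j := by
    intro i hi
    rw [← Finset.mem_singleton, ← hj, mem_colorIndices]
    rw [mem_colorIndices] at hi
    cases c <;> simpa using hi
  have hjc : (part v f j).card ≤ 2 := by
    rw [← hfx]
    refine (Finset.card_le_card fun z hz => ?_).trans (Finset.card_le_two (a := x) (b := y))
    simpa using hpart z hz
  have hsum := card_eq_sum_parts M c v f
  rw [hj, Finset.sum_singleton] at hsum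
  rw [hl] at hcard
  have hin : ∀ i ∈ colorIndices M c, ∀ u ∈ part v f i, ∀ w ∈ part v f i, TwinOff A c ∅ u w := by
    intro i hi u hu w hw
    rw [mem_part] at hu hw
    have := hf.twin hu.1 hw.1 (hu.2.trans hw.2.symm)
    rw [hu.2, mem_colorIndices.1 hi] at this
    exact TwinOff.of_deleted_same hvx hne this hu.1 hw.1
  have htwin : ∀ u, u ≠ y → ∃ w, TwinOff A c ∅ u w ∧ u ≠ w := by
    intro u huy
    by_contra hno
    push Not at hno
    have huv : u ≠ v := by rintro rfl; exact hne (hno x hvx)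
    have hux : u ≠ x := by rintro rfl; exact hne (hno v hvx.symm).symm
    have hfu : f u ∈ colorIndices M c := by
      by_contra hfu
      rcases hpart u (mem_part.2 ⟨huv, (hcn _ hfu).trans hfx.symm⟩) with h3 | h3
      exacts [hux h3, huy h3]
    -- The count is tight: a part of colour `c` with fewer than two vertices would leave at most `2k
    -- + 2` vertices in all.
    have h3 : ∑ i ∈ colorIndices M c, (part v f i).card < ∑ i ∈ colorIndices M c, 2 := by
      refine Finset.sum_lt_sum (fun i hi => card_part_le (h2 c) (hin i hi)) ⟨f u, hfu, ?_⟩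
      refine Nat.lt_succ_of_le (le_trans (Finset.card_le_card fun w hw => ?_)
        (card_twinClass_le_one hno))
      exact mem_twinClass.2 (hin _ hfu u (mem_part.2 ⟨huv, rfl⟩) w hw)
    rw [Finset.sum_const, smul_eq_mul] at h3
    omega
  have hsee : ∀ u, u ≠ y → A u y = (!c) ∧ A y u = !c := by
    intro u huy
    obtain ⟨w, hw, huw⟩ := htwin u huy
    obtain ⟨g, hg⟩ := h.hom_off u
    obtain ⟨t, -, ht1, ht2, ht, -⟩ := h.exists_untwinned (by rw [hl]; exact hcard) h2 hw huw hg
    -- Only `y` lacks a `c`-twin, so every pair of twins yields this same vertex.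
    have : t = y := by
      by_contra hty
      obtain ⟨w, hw, hne⟩ := htwin t hty
      exact hne (ht c w hw)
    subst this
    exact ⟨ht1, ht2⟩
  obtain ⟨g, hg⟩ := h.hom_off y
  choose! τ hτ hτne using htwin
  have hτy : ∀ u, u ≠ y → τ u ≠ y := by
    intro u hu h3
    have := (hτ u hu).symm
    rw [h3] at this
    exact hu (hy c u this).symm
  have hcc : c ≠ !c := by cases c <;> simp
  have hgin : ∀ u w, u ≠ y → w ≠ y → g u ∈ colorIndices M c → g u = g w →
      TwinOff A c ∅ u w := by
    intro u w hu hw hgu huw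
    have h3 := hg.twin hu hw huw
    rw [mem_colorIndices.1 hgu] at h3
    refine h3.of_deleted ?_
    rw [code_of_ne hu, code_of_ne hw, (hsee u hu).1, (hsee u hu).2, (hsee w hw).1, (hsee w hw).2]
  -- Every vertex other than `y`, or its twin, is in a part of colour `c`.
  have hrep : ∀ u, u ≠ y → ∃ w, w ≠ y ∧ TwinOff A c ∅ u w ∧ g w ∈ colorIndices M c := by
    intro u hu
    by_cases hgu : g u ∈ colorIndices M c
    · exact ⟨u, hu, TwinOff.refl _, hgu⟩
    · refine ⟨τ u, hτy u hu, hτ u hu, ?_⟩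
      by_contra hgt
      have h3 := (hg.twin hu (hτy u hu) ((hcn _ hgu).trans (hcn _ hgt).symm)).color
        (S := {y}) hu (hτne u hu)
      have hju : M (g u) (g u) = !c := by
        rw [hcn _ hgu, ← mem_colorIndices, hj]; simp
      rw [hju, ((hτ u hu).color (Set.notMem_empty _) (hτne u hu)).1] at h3
      exact hcc h3.1
  choose! ρ hρy hρ hρg using hrep
  have h3 : (Finset.univ.erase y).card ≤ 2 * (colorIndices M c).card := by
    -- Vertices with equal `g (ρ u)` are twins, so `D - y` has at most `2k` vertices.
    refine Finset.card_le_mul_card_image_of_maps_to (f := fun u => g (ρ u)) ?_ 2 ?_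
    · intro u hu
      exact hρg u (Finset.ne_of_mem_erase hu)
    · intro i _
      rcases (Finset.filter (fun u => g (ρ u) = i) (Finset.univ.erase y)).eq_empty_or_nonempty
        with h0 | ⟨u, hu⟩
      · simp [h0]
      · refine (Finset.card_le_card fun w hw => mem_twinClass.2 ?_).trans (h2 c u)
        simp only [Finset.mem_filter, Finset.mem_erase, Finset.mem_univ, and_true] at hu hw
        exact (hρ u hu.1).trans ((hgin _ _ (hρy u hu.1) (hρy w hw.1) (hρg u hu.1)
          (hu.2.trans hw.2.symm)).trans (hρ w hw.1).symm)
  rw [Finset.card_erase_of_mem (Finset.mem_univ _), Finset.card_univ] at h3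
  omega

/-- The bound, if all twin classes have at most two vertices and there is a twin class of colour `c`
with two vertices. -/
theorem card_le_of_twins (h : IsCritical A M) (hk : 1 ≤ (colorIndices M c).card)
    (h2 : ∀ c x, (twinClass A c x).card ≤ 2) (hvx : TwinOff A c ∅ v x) (hne : v ≠ x) :
    Fintype.card V ≤ ((colorIndices M c).card + 1) * ((colorIndices M (!c)).card + 1) := by
  classical
  by_contra hcard
  have hcard' := not_le.1 hcard
  obtain ⟨f, hf⟩ := h.hom_off v
  obtain ⟨y, hyv, -, -, hy, hpart⟩ := h.exists_untwinned hcard' h2 hvx hne hf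
  have hv2 : (twinClass A c v).card = 2 := by
    refine le_antisymm (h2 c v) ?_
    rw [← Finset.card_pair hne]
    refine Finset.card_le_card fun t ht => mem_twinClass.2 ?_
    rcases Finset.mem_insert.1 ht with rfl | ht
    · exact TwinOff.refl _
    · rw [Finset.mem_singleton.1 ht]; exact hvx
  have hs : ∀ w, TwinOff A c ∅ v w → v ≠ w → (part v f (f w)).card ≤ 2 := by
    intro w hw hvw
    obtain ⟨t, -, -, -, -, ht⟩ := h.exists_untwinned hcard' h2 hw hvw hf
    refine (Finset.card_le_card fun z hz => ?_).trans (Finset.card_le_two (a := w) (b := t))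
    simpa using ht z hz
  have hl1 : 1 ≤ (colorIndices M (!c)).card :=
    Finset.card_pos.2 ⟨f x, mem_colorIndices.2 (h.color_of_twin hf hvx hne)⟩
  have hl2 : (colorIndices M (!c)).card ≠ 1 := fun hl =>
    hcard (h.card_le_of_unique_index hl h2 hvx hne)
  -- Both opposite parts beyond the first and `b ≤ k` are needed for the sum to stay within the
  -- bound; `b` is 2 or 1 according to whether opposite twins exist.
  have count : ∀ b, (∀ x, (twinClass A (!c) x).card ≤ b) → b ≤ (colorIndices M c).card → False := by
    intro b hb hbk
    have h3 := h.card_le_of_twin hf hvx hne (h2 c) hb hs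
    rw [hv2] at h3
    obtain ⟨l, hl⟩ := Nat.exists_eq_add_of_le (show 2 ≤ (colorIndices M (!c)).card by omega)
    rw [hl] at h3 hcard'
    nlinarith [Nat.mul_le_mul_left l hbk]
  by_cases hex : ∃ u w, TwinOff A (!c) ∅ u w ∧ u ≠ w
  · obtain ⟨u, w, huw, hne'⟩ := hex
    have hk1 : (colorIndices M c).card = 1 := by
      by_contra hk1
      exact count 2 (h2 _) (by omega)
    refine hcard ?_
    have := h.card_le_of_unique_index (c := !c) (by rwa [Bool.not_not]) h2 huw hne'
    rwa [Bool.not_not, mul_comm] at this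
  · push Not at hex
    exact count 1 (fun u => card_twinClass_le_one (hex u)) hk

/-- Without twins of colour `c`, some vertex can be deleted without creating such twins. -/
theorem exists_twinOff_imp_eq [Nonempty V]
    (h : ∀ x y, TwinOff A c ∅ x y → x = y) :
    ∃ v, ∀ x y, TwinOff A c {v} x y → x = y :=
  exists_redundant_coordinate (code A c) fun x y hxy => h x y fun z _ => congrFun hxy z

/-- The bound, if there are no parts of colour `c`. -/
theorem card_le_of_no_index [Nonempty V] (h : IsCritical A M) (hk : (colorIndices M c).card = 0) :
    Fintype.card V ≤ ((colorIndices M c).card + 1) * ((colorIndices M (!c)).card + 1) := by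
  classical
  have h1 : ∀ x y, TwinOff A (!c) ∅ x y → x = y := by
    intro x y hxy
    have := h.card_twinClass_le (!c) x
    rw [Bool.not_not, hk] at this
    exact Finset.card_le_one.1 this x (mem_twinClass.2 (TwinOff.refl _)) y (mem_twinClass.2 hxy)
  obtain ⟨v, hv⟩ := exists_twinOff_imp_eq h1
  obtain ⟨f, hf⟩ := h.hom_off v
  have hsum := card_eq_sum_parts M c v f
  have h2 : ∑ i ∈ colorIndices M (!c), (part v f i).card ≤ (colorIndices M (!c)).card * 1 := by
    refine Finset.sum_le_card_nsmul _ _ _ fun i hi => Finset.card_le_one.2 fun x hx y hy => ?_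
    rw [mem_part] at hx hy
    have := hf.twin hx.1 hy.1 (hx.2.trans hy.2.symm)
    rw [hx.2, mem_colorIndices.1 hi] at this
    exact hv x y this
  rw [Finset.card_eq_zero.1 hk, Finset.sum_empty] at hsum
  rw [hk]
  omega

/-- A graph without twins that has a part of size three after the deletion of a vertex is small. -/
theorem card_le_of_large_part (h : IsCritical A M)
    (h1 : ∀ c x y, TwinOff A c ∅ x y → x = y) (hf : IsFullHomOff A M v f) {i : ι}
    (hi : 2 < (part v f i).card) : Fintype.card V ≤ Fintype.card ι + 2 := by
  classical
  obtain ⟨x, hx, y, hy, z, hz, hxy, hxz, hyz⟩ := Finset.two_lt_card.1 hi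
  rw [mem_part] at hx hy hz
  obtain ⟨g, hg⟩ := h.hom_off x
  have twin : ∀ {s t}, (s ≠ v ∧ f s = i) → (t ≠ v ∧ f t = i) → TwinOff A (M i i) {v} s t := by
    intro s t hs ht
    have := hf.twin hs.1 ht.1 (hs.2.trans ht.2.symm)
    rwa [hs.2] at this
  -- A vertex `t` in the part of `x` separates the same pairs as `x` does.
  have key : ∀ t, t ≠ v → f t = i → t ≠ x → ∀ p q, p ≠ v → q ≠ v → p ≠ x → q ≠ x → p ≠ t → q ≠ t →
      g p = g q → p = q := by
    intro t htv hti htx p q hpv hqv hpx hqx hpt hqt hpq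
    refine h1 _ p q ((hg.twin hpx hqx hpq).of_deleted ?_)
    have hxt := twin hx ⟨htv, hti⟩
    have h3 := hxt.third (S := {v}) hpv hpx hpt
    have h4 := hxt.third (S := {v}) hqv hqx hqt
    have h5 := hg.twin hpx hqx hpq t htx
    rw [code_of_ne hpt, code_of_ne hqt] at h5
    rw [code_of_ne hpx, code_of_ne hqx, h3.1, h3.2, h4.1, h4.2, h5]
  -- `key` with `t = y` or `t = z` misses only this pair; here `x` itself sees `y` and `z` alike.
  have hyz' : g y ≠ g z := by
    intro hgyz
    have h3 := hg.twin hxy.symm hxz.symm hgyz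
    have h4 := twin hy hz
    have h5 : M (g y) (g y) = M i i :=
      (h3.color (S := {x}) hxy.symm hyz).1.symm.trans (h4.color (S := {v}) hy.1 hyz).1
    rw [h5] at h3
    exact hyz (h1 _ y z (h3.of_deleted (h4 x hx.1)))
  have hinj : Set.InjOn g ((Finset.univ.erase x).erase v : Finset V) := by
    intro p hp q hq hpq
    simp only [Finset.coe_erase, Finset.coe_univ, Set.mem_sdiff, Set.mem_univ, true_and,
      Set.mem_singleton_iff] at hp hq
    by_cases hpy : p = y
    · subst hpy
      by_cases hqz : q = z
      · subst hqz; exact (hyz' hpq).elim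
      · exact key z hz.1 hz.2 hxz.symm p q hp.2 hq.2 hp.1 hq.1 hyz hqz hpq
    by_cases hqy : q = y
    · subst hqy
      by_cases hpz : p = z
      · subst hpz; exact (hyz' hpq.symm).elim
      · exact key z hz.1 hz.2 hxz.symm p q hp.2 hq.2 hp.1 hq.1 hpz hyz hpq
    exact key y hy.1 hy.2 hxy.symm p q hp.2 hq.2 hp.1 hq.1 hpy hqy hpq
  have h3 := Finset.card_le_card_of_injOn g (fun _ _ => Finset.mem_univ _) hinj
  have h4 := Finset.pred_card_le_card_erase (s := Finset.univ.erase x) (a := v)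
  rw [Finset.card_erase_of_mem (Finset.mem_univ _)] at h4
  simp only [Finset.card_univ] at h3 h4
  omega

/-- The bound, if there are no twins and there are parts of both colours. -/
theorem card_le_of_no_twins [Nonempty V] (h : IsCritical A M)
    (h1 : ∀ c x y, TwinOff A c ∅ x y → x = y)
    (hk : 1 ≤ (colorIndices M c).card) (hl : 1 ≤ (colorIndices M (!c)).card) :
    Fintype.card V ≤ ((colorIndices M c).card + 1) * ((colorIndices M (!c)).card + 1) := by
  classical
  obtain ⟨v, hv⟩ := exists_twinOff_imp_eq (h1 c)
  obtain ⟨f, hf⟩ := h.hom_off v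
  by_cases hbig : ∃ i, 2 < (part v f i).card
  · obtain ⟨i, hi⟩ := hbig
    have h2 := h.card_le_of_large_part h1 hf hi
    rw [← card_colorIndices_add M c] at h2
    nlinarith [Nat.mul_le_mul hk hl]
  push Not at hbig
  have hsum := card_eq_sum_parts M c v f
  have h2 : ∑ i ∈ colorIndices M (!c), (part v f i).card ≤ (colorIndices M (!c)).card * 2 :=
    Finset.sum_le_card_nsmul _ _ _ fun i _ => hbig i
  have h3 : ∑ i ∈ colorIndices M c, (part v f i).card ≤ (colorIndices M c).card * 1 := by
    refine Finset.sum_le_card_nsmul _ _ _ fun i hi => Finset.card_le_one.2 fun x hx y hy => ?_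
    rw [mem_part] at hx hy
    have := hf.twin hx.1 hy.1 (hx.2.trans hy.2.symm)
    rw [hx.2, mem_colorIndices.1 hi] at this
    exact hv x y this
  -- The total `1 + k + 2l` is within the bound because `l ≤ kl`.
  nlinarith [Nat.mul_le_mul_right (colorIndices M (!c)).card hk]

/-- A critical digraph has at most `(k + 1) * (l + 1)` vertices. -/
theorem card_le (h : IsCritical A M) :
    Fintype.card V ≤
      ((colorIndices M false).card + 1) * ((colorIndices M true).card + 1) := by
  cases isEmpty_or_nonempty V
  · simp
  have swap : ∀ c, Fintype.card V ≤
        ((colorIndices M c).card + 1) * ((colorIndices M (!c)).card + 1) →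
      Fintype.card V ≤ ((colorIndices M false).card + 1) * ((colorIndices M true).card + 1) := by
    rintro (_ | _) hc
    · exact hc
    · rwa [Bool.not_true, mul_comm] at hc
  by_cases h0 : ∃ c, (colorIndices M c).card = 0
  · obtain ⟨c, hc⟩ := h0
    exact swap c (h.card_le_of_no_index hc)
  push Not at h0
  by_cases h3 : ∃ c x, 3 ≤ (twinClass A c x).card
  · obtain ⟨c, x, hx⟩ := h3
    obtain ⟨v, hv⟩ := Finite.exists_max fun x => (twinClass A c x).card
    exact swap c (h.card_le_of_large_twinClass (hx.trans (hv x)) hv)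
  push Not at h3
  by_cases h2 : ∃ c v x, TwinOff A c ∅ v x ∧ v ≠ x
  · obtain ⟨c, v, x, hvx, hne⟩ := h2
    exact swap c (h.card_le_of_twins (Nat.one_le_iff_ne_zero.2 (h0 c))
      (fun c x => Nat.le_of_lt_succ (h3 c x)) hvx hne)
  push Not at h2
  exact h.card_le_of_no_twins h2 (Nat.one_le_iff_ne_zero.2 (h0 _))
    (Nat.one_le_iff_ne_zero.2 (h0 _))

end IsCritical

end Critical

/-! ### From matrix partitions to full homomorphisms -/

section MatrixPartition

variable {V ι : Type*} {D : Digraph V} {M : Matrix ι ι (Fin 2)}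

theorem hasMatrixPartition_iff (hD : D.IsLoopless) :
    D.HasMatrixPartition M ↔ ∃ f : V → ι, D.IsFullHom (ofMatrix M) f := by
  constructor
  · rintro ⟨P, hP⟩
    have hcov : ∀ x, ∃ i, x ∈ P i := fun x => Set.mem_iUnion.1 (hP.cover ▸ Set.mem_univ x)
    choose f hf using hcov
    refine ⟨f, fun x y hxy => ?_⟩
    change D.Adj x y ↔ M (f x) (f y) = 1
    by_cases hfxy : f x = f y
    · have hy : y ∈ P (f x) := hfxy ▸ hf y
      rw [← hfxy]
      constructor
      · intro hadj
        by_contra h1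
        exact (hP.independent (f x) (by omega) x (hf x) y hy).1 hadj
      · intro h1
        exact (hP.strongClique (f x) h1 x (hf x) y hy hxy).1
    · constructor
      · intro hadj
        by_contra h1
        exact hP.nonAdjacent (f x) (f y) hfxy (by omega) x (hf x) y (hf y) hadj
      · intro h1
        exact hP.adjacent (f x) (f y) hfxy h1 x (hf x) y (hf y)
  · rintro ⟨f, hf⟩
    have hf : ∀ x y, x ≠ y → (D.Adj x y ↔ M (f x) (f y) = 1) := hf
    have hindep : ∀ i x y, M i i = 0 → f x = i → f y = i → ¬ D.Adj x y := by
      intro i x y hi hx hy hadj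
      -- Independence also concerns `x = y`, which full homomorphisms leave free; looplessness fills
      -- the gap.
      by_cases hxy : x = y
      · exact hD x (by rwa [← hxy] at hadj)
      · rw [hf x y hxy, hx, hy, hi] at hadj
        exact absurd hadj (by decide)
    refine ⟨fun i => f ⁻¹' {i}, ?_, ?_, ?_, ?_, ?_, ?_⟩
    · intro i j hij
      exact Set.disjoint_left.2 fun x hx hx' => hij (Eq.trans (Eq.symm hx) hx')
    · exact Set.eq_univ_of_forall fun x => Set.mem_iUnion.2 ⟨f x, rfl⟩
    · intro i hi x hx y hy
      exact ⟨hindep i x y hi hx hy, hindep i y x hi hy hx⟩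
    · rintro i hi x rfl y hy hxy
      rw [hf x y hxy, hf y x hxy.symm, show f y = f x from hy]
      exact ⟨hi, hi⟩
    · rintro i j hij h0 x rfl y rfl hadj
      rw [hf x y fun e => hij (congrArg f e), h0] at hadj
      exact absurd hadj (by decide)
    · rintro i j hij h1 x rfl y rfl
      exact (hf x y fun e => hij (congrArg f e)).2 h1

open Classical in
theorem IsMinimalObstruction.isCritical [Nonempty ι] (hD : D.IsLoopless)
    (h : D.IsMinimalObstruction M) :
    IsCritical (fun x y => decide (D.Adj x y)) (fun i j => decide (M i j = 1)) where
  not_hom := by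
    rintro ⟨f, hf⟩
    exact h.1 ((hasMatrixPartition_iff hD).2 ⟨f, fun x y hxy => decide_eq_decide.1 (hf x y hxy)⟩)
  hom_off v := by
    have hDv : (D.deleteVertex v).IsLoopless := fun x => hD x
    obtain ⟨f, hf⟩ := (hasMatrixPartition_iff hDv).1 (h.2 v)
    -- The value at `v` is irrelevant to `IsFullHomOff`.
    refine ⟨fun x => if hx : x ≠ v then f ⟨x, hx⟩ else Classical.arbitrary ι, ?_⟩
    intro x y hx hy hxy
    simp only [dif_pos hx, dif_pos hy]
    exact decide_eq_decide.2 (hf ⟨x, hx⟩ ⟨y, hy⟩ fun e => hxy (congrArg Subtype.val e))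

end MatrixPartition

end Digraph

theorem mainTheorem1 {ι V : Type*} [Fintype ι] [Fintype V]
    (M : Matrix ι ι (Fin 2)) (k l : ℕ)
    (hk : (Finset.univ.filter fun i => M i i = 0).card = k)
    (hl : (Finset.univ.filter fun i => M i i = 1).card = l)
    (D : Digraph V) (hD : D.IsLoopless) :
    (D.HasMatrixPartition M ↔ ∃ f : V → ι, D.IsFullHom (Digraph.ofMatrix M) f) ∧
    (D.IsMinimalObstruction M → Fintype.card V ≤ (k + 1) * (l + 1)) := by
  refine ⟨Digraph.hasMatrixPartition_iff hD, fun h => ?_⟩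
  cases isEmpty_or_nonempty ι
  -- With no parts, `D - y` has a partition only if it is empty.
  · have hsub : Subsingleton V := by
      refine ⟨fun x y => ?_⟩
      by_contra hxy
      have hDy : (D.deleteVertex y).IsLoopless := fun x => hD x
      obtain ⟨f, -⟩ := (Digraph.hasMatrixPartition_iff hDy).1 (h.2 y)
      exact isEmptyElim (f ⟨x, hxy⟩)
    exact (Fintype.card_le_one_iff_subsingleton.2 hsub).trans
      (Nat.mul_pos k.succ_pos l.succ_pos)
  · have h1 := (h.isCritical hD).card_le
    have h2 : (Digraph.colorIndices (fun i j => decide (M i j = 1)) false).card = k := by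
      rw [← hk]
      congr 1
      ext i
      simp only [Digraph.mem_colorIndices, Finset.mem_filter, Finset.mem_univ, true_and,
        decide_eq_false_iff_not]
      omega
    have h3 : (Digraph.colorIndices (fun i j => decide (M i j = 1)) true).card = l := by
      rw [← hl]
      congr 1
      ext i
      simp [Digraph.mem_colorIndices]
    rwa [h2, h3] at h1
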